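/- An overpartition of $n\ge 0$ is a non-increasing sequence of positive integers $\lambda_1\ge\cdots\ge\lambda_s$ with sum $n$ in which the first occurrence of each integer may be overlined. For an overpartition $\lambda$ and $l\ge1$, let $f_l(\lambda)$ and $f_{\overline l}(\lambda)$ be the numbers of occurrences of $l$ as a non-overlined and as an overlined part. For integers $k\ge a\ge 1$: - $U_{k,a}(n)$ is the number of overpartitions $\lambda$ of $n$ such that for all $l\ge1$: $f_1\le a-1+f_{\overline 1}$; $f_{2l-1}\ge f_{\overline{2l-1}}$; $f_{2l}+f_{\overline{2l}}$ is even; and $f_l+f_{\overline l}+f_{l+1}\le k-1+f_{\overline{l+1}}$. - $\overline U_{k,a}(n)$ is the number of overpartitions $\lambda$ of $n$ such that for all $l\ge1$: $f_1\le a-1+f_{\overline 1}$; $f_{2l}\ge f_{\overline{2l}}$; $f_{2l-1}+f_{\overline{2l-1}}$ is even; and $f_l+f_{\overline l}+f_{l+1}\le k-1+f_{\overline{l+1}}$. - $\overline B_{k,a}(n)$ is the number of overpartitions $\lambda_1\ge\cdots\ge\lambda_s$ of $n$ in which $1$ occurs non-overlined at most $a-1$ times and, for all $j$ with $1\le j\le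 s-k+1$, $\lambda_j-\lambda_{j+k-1}\ge1$ if $\lambda_j$ is overlined and $\lambda_j-\lambda_{j+k-1}\ge2$ otherwise. Write $(x;q)_\infty=\prod_{i\ge0}(1-xq^i)$. Theorem. For all integers $k\ge a\ge1$, as formal power series in $q$, $$\sum_{n\ge0}U_{2k,2a}(n)q^n=(-q;q^2)_\infty\sum_{n\ge0}\overline B_{k,a}(n)q^{2n},\qquad \sum_{n\ge0}\overline U_{2k,2a}(n)q^n=(-q^2;q^2)_\infty\sum_{n\ge0}\overline B_{k,a}(n)q^{2n}.$$ Moreover, both identities are realized bijectively. For each $n\ge0$, send an overpartition $\lambda$ counted by $U_{2k,2a}(n)$ to the pair $(\gamma,\beta')$, where $\gamma$ has as its parts one copy of each odd $l$ for which $f_l(\lambda)+f_{\overline l}(\lambda)$ is odd, $\beta$ is obtained from $\lambda$ by removing one non-overlined copy of each part of $\gamma$, and $\beta'$ is obtained from $\beta$ by adding the equal parts $l,l$ in pairs and dividing by $2$: every $l$ occurs in $\beta'$ (overlined and non-overlined together) half as often as in $\beta$, and $l$ is overlined in $\beta'$ if and only if it is in $\beta$. This map is a bijection onto the set of pairs $(\gamma,\beta')$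 in which $\gamma$ is a partition into distinct odd parts, $\beta'$ is an overpartition counted by $\overline B_{k,a}(|\beta'|)$, and $|\gamma|+2|\beta'|=n$. In the same way, with "odd $l$" replaced by "even $l$", the map is a bijection from the overpartitions counted by $\overline U_{2k,2a}(n)$ onto the set of pairs $(\gamma,\beta')$ in which $\gamma$ is a partition into distinct positive even parts, $\beta'$ is counted by $\overline B_{k,a}(|\beta'|)$, and $|\gamma|+2|\beta'|=n$. -/

import Mathlib

open PowerSeries

/-- An overpartition: a finite non-increasing sequence of positive integers in which the first
occurrence of each integer may be overlined. It is recorded by the multiset of its non-overlined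
parts and the set of its overlined parts (each integer is overlined at most once). -/
@[ext]
structure Overpartition where
  plain : Multiset ℕ
  lined : Finset ℕ
  plain_pos : ∀ l ∈ plain, 0 < l
  lined_pos : ∀ l ∈ lined, 0 < l

namespace Overpartition

/-- All the parts, overlined or not, with multiplicity. -/
def parts (p : Overpartition) : Multiset ℕ := p.plain + p.lined.val

/-- The number of which `p` is an overpartition. -/
def size (p : Overpartition) : ℕ := p.parts.sum

/-- The number `f_l` of occurrences of `l` as a non-overlined part. -/
def f (p : Overpartition) (l : ℕ) : ℕ := p.plain.count l

/-- The number of occurrences (0 or 1) of `l` as an overlined part. -/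
def fbar (p : Overpartition) (l : ℕ) : ℕ := if l ∈ p.lined then 1 else 0

/-- The non-increasing sequence of the parts (indexed from 0). -/
def seq (p : Overpartition) : List ℕ := p.parts.sort (· ≥ ·)

/-- The part at position `i` of the sequence is overlined: its value occurs overlined,
and position `i` is the first occurrence of that value. -/
def IsOverlinedAt (p : Overpartition) (i : ℕ) : Prop :=
  ∃ hi : i < p.seq.length, p.seq[i] ∈ p.lined ∧
    ∀ j, ∀ hj : j < i, p.seq[j] ≠ p.seq[i]

/-- The overpartitions counted by `U_{k,a}`. -/
structure IsU (k a : ℕ) (p : Overpartition) : Prop where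
  one : p.f 1 ≤ (a - 1) + p.fbar 1
  odd : ∀ l, Odd l → p.fbar l ≤ p.f l
  even : ∀ l, Even l → Even (p.f l + p.fbar l)
  adjacent : ∀ l, 1 ≤ l → p.f l + p.fbar l + p.f (l + 1) ≤ (k - 1) + p.fbar (l + 1)

/-- The overpartitions counted by `Ubar_{k,a}`. -/
structure IsUbar (k a : ℕ) (p : Overpartition) : Prop where
  one : p.f 1 ≤ (a - 1) + p.fbar 1
  even : ∀ l, Even l → p.fbar l ≤ p.f l
  odd : ∀ l, Odd l → Even (p.f l + p.fbar l)
  adjacent : ∀ l, 1 ≤ l → p.f l + p.fbar l + p.f (l + 1) ≤ (k - 1) + p.fbar (l + 1)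

/-- The overpartitions counted by `Bbar_{k,a}`: the part `1` occurs non-overlined at most `a - 1`
times, and for any two positions `i`, `j = i + k - 1` of the sequence the difference of the parts
is at least `1` if the part at `i` is overlined and at least `2` otherwise. -/
structure IsBbar (k a : ℕ) (p : Overpartition) : Prop where
  one : p.f 1 ≤ a - 1
  diff : ∀ i j, ∀ hi : i < p.seq.length, ∀ hj : j < p.seq.length, j + 1 = i + k →
    (p.IsOverlinedAt i → p.seq[j] + 1 ≤ p.seq[i]) ∧
    (¬ p.IsOverlinedAt i → p.seq[j] + 2 ≤ p.seq[i])

/-- There are finitely many overpartitions of `n`, so the cardinalities below are genuine. -/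
theorem finite_size_eq (n : ℕ) : {p : Overpartition | p.size = n}.Finite := by
  have hle : ∀ p : Overpartition, p.size = n → ∀ l ∈ p.parts, l ≤ n := by
    intro p hp l hl
    rw [← hp]
    exact Multiset.le_sum_of_mem hl
  have hcard : ∀ p : Overpartition, p.size = n → p.plain.card ≤ n := by
    intro p hp
    have h1 : p.plain.card • 1 ≤ p.plain.sum :=
      Multiset.card_nsmul_le_sum fun l hl => p.plain_pos l hl
    have h2 : p.plain.sum + p.lined.val.sum = n := by
      rw [← hp, size, parts, Multiset.sum_add]
    simp only [smul_eq_mul, mul_one] at h1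
    omega
  have hfin : (Set.Iic (n • (Finset.range (n + 1)).val) ×ˢ
      (↑(Finset.range (n + 1)).powerset : Set (Finset ℕ))).Finite :=
    (Set.finite_Iic _).prod (Finset.finite_toSet _)
  refine Set.Finite.of_finite_image (f := fun p : Overpartition => (p.plain, p.lined))
    (hfin.subset ?_) ?_
  · rintro _ ⟨p, hp, rfl⟩
    refine ⟨?_, ?_⟩
    · refine Multiset.le_iff_count.2 fun l => ?_
      by_cases hl : l ∈ p.plain
      · have h1 : l ≤ n := hle p hp l (Multiset.mem_add.2 (Or.inl hl))
        have h2 : (Finset.range (n + 1)).val.count l = 1 :=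
          Multiset.count_eq_one_of_mem (Finset.range (n + 1)).nodup
            (Finset.mem_range.2 (by omega))
        rw [Multiset.count_nsmul, h2, mul_one]
        exact (Multiset.count_le_card _ _).trans (hcard p hp)
      · rw [Multiset.count_eq_zero_of_notMem hl]
        exact Nat.zero_le _
    · refine Finset.mem_coe.2 (Finset.mem_powerset.2 fun l hl => ?_)
      have := hle p hp l (Multiset.mem_add.2 (Or.inr hl))
      exact Finset.mem_range.2 (by omega)
  · intro p _ r _ h
    exact Overpartition.ext (congrArg Prod.fst h) (congrArg Prod.snd h)

/-- `U_{k,a}(n)`. -/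
noncomputable def U (k a n : ℕ) : ℕ := {p : Overpartition | p.size = n ∧ p.IsU k a}.ncard

/-- `Ubar_{k,a}(n)`. -/
noncomputable def Ubar (k a n : ℕ) : ℕ := {p : Overpartition | p.size = n ∧ p.IsUbar k a}.ncard

/-- `Bbar_{k,a}(n)`. -/
noncomputable def Bbar (k a n : ℕ) : ℕ := {p : Overpartition | p.size = n ∧ p.IsBbar k a}.ncard

/-- The odd `l` whose total multiplicity (overlined and non-overlined) is odd. -/
def oddRemoved (p : Overpartition) : Finset ℕ :=
  p.parts.toFinset.filter fun l => Odd l ∧ Odd (p.f l + p.fbar l)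

/-- The even `l` whose total multiplicity (overlined and non-overlined) is odd. -/
def evenRemoved (p : Overpartition) : Finset ℕ :=
  p.parts.toFinset.filter fun l => Even l ∧ Odd (p.f l + p.fbar l)

/-- Remove one non-overlined copy of each element of `s`. -/
def remove (p : Overpartition) (s : Finset ℕ) : Overpartition where
  plain := p.plain - s.val
  lined := p.lined
  plain_pos l hl := p.plain_pos l (Multiset.mem_of_le (Multiset.sub_le_self _ _) hl)
  lined_pos := p.lined_pos

/-- Replace each pair `l, l` of equal parts by `l + l` and divide by `2`: the total multiplicity
of each `l` is halved, and `l` occurs overlined in the result if and only if it does in `p`. -/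
def mergeHalve (p : Overpartition) : Overpartition where
  plain := ∑ l ∈ p.parts.toFinset, Multiset.replicate ((p.f l + p.fbar l) / 2 - p.fbar l) l
  lined := p.lined
  plain_pos l hl := by
    obtain ⟨m, hm, h⟩ := Multiset.mem_sum.1 hl
    obtain rfl := Multiset.eq_of_mem_replicate h
    rcases Multiset.mem_add.1 (Multiset.mem_toFinset.1 hm) with h' | h'
    · exact p.plain_pos _ h'
    · exact p.lined_pos _ h'
  lined_pos := p.lined_pos

end Overpartition

section QPochhammer

open scoped PowerSeries.WithPiTopology

/-- `(a; q)_∞ = ∏_{i ≥ 0} (1 - a q^i)`, for formal power series with integer coefficients,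
with the topology of coefficientwise convergence. -/
noncomputable def qPoch (a q : ℤ⟦X⟧) : ℤ⟦X⟧ := ∏' i : ℕ, (1 - a * q ^ i)

/-- The infinite product converges when `q` has no constant term. -/
theorem multipliable_qPoch (a q : ℤ⟦X⟧) (hq : constantCoeff q = 0) :
    Multipliable fun i : ℕ => 1 - a * q ^ i := by
  simp only [sub_eq_add_neg]
  apply PowerSeries.WithPiTopology.multipliable_one_add_of_tendsto_order_atTop_nhds_top
  refine ENat.tendsto_nhds_top_iff_natCast_lt.2 fun N => ?_
  filter_upwards [Filter.eventually_gt_atTop N] with i hi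
  refine lt_of_lt_of_le (Nat.cast_lt.2 hi) (PowerSeries.nat_le_order _ _ fun j hj => ?_)
  obtain ⟨r, hr⟩ := PowerSeries.X_dvd_iff.2 hq
  rw [hr, mul_pow, ← mul_assoc, mul_comm a, mul_assoc, ← mul_neg, PowerSeries.coeff_X_pow_mul',
    if_neg (by omega)]

end QPochhammer

/-! Everything reduces to multiplicities. For a non-increasing sequence, the gap condition of
`IsBbar` is equivalent to `f 1 ≤ a - 1` together with `f l + fbar l + f (l + 1) ≤ k - 1` for `l ≥ 1`
(`isBbar_iff`).

The inverse map sends `(s, p)` to the overpartition with the same overlined parts and `2 * f l +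
fbar l + [l ∈ s]` plain copies of `l`. Its adjacency condition reads `2 * (f l + fbar l + f (l + 1))
+ [l ∈ s] + [l + 1 ∈ s] ≤ 2 * k - 1`. Elements of `s` share a parity, so the brackets add up to at
most `1`, and the condition is exactly the one for `p` (`isRestricted_doubleInsert_iff`). The parity
of the total multiplicities recovers `s`. Both cases run through one predicate `P` that never holds
at two consecutive integers. Counting the pairs by weight then gives the product of series. -/

/-- In a non-increasing list, the entries that are at least `m` form the initial segment whose
length is their number. -/
theorem List.Pairwise.le_getElem_iff_lt_countP {L : List ℕ} (hL : L.Pairwise (· ≥ ·)) (m i : ℕ)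
    (hi : i < L.length) : m ≤ L[i] ↔ i < L.countP (m ≤ ·) := by
  induction L generalizing i with
  | nil => simp at hi
  | cons x L ih =>
    rw [List.pairwise_cons] at hL
    by_cases hx : m ≤ x
    · rw [List.countP_cons_of_pos (by simpa using hx)]
      cases i with
      | zero => simpa using hx
      | succ i => simpa using ih hL.2 i (by simpa using hi)
    · have h0 : (x :: L).countP (m ≤ ·) = 0 := by
        rw [List.countP_eq_zero]
        intro y hy
        rcases List.mem_cons.1 hy with rfl | hy
        · simpa using hx
        · have := hL.1 y hy
          simp only [decide_eq_true_eq]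
          omega
      rw [h0]
      have : (x :: L)[i] ≤ x := by
        cases i with
        | zero => simp
        | succ i => exact hL.1 _ (by simp)
      omega

namespace Overpartition

theorem ext_f {p r : Overpartition} (h : ∀ l, p.f l = r.f l) (h' : p.lined = r.lined) : p = r :=
  Overpartition.ext (Multiset.ext.2 h) h'

theorem fbar_le_one (p : Overpartition) (l : ℕ) : p.fbar l ≤ 1 := by
  unfold fbar
  split_ifs <;> simp

theorem fbar_of_mem {p : Overpartition} {l : ℕ} (h : l ∈ p.lined) : p.fbar l = 1 := if_pos h

theorem count_parts (p : Overpartition) (l : ℕ) : p.parts.count l = p.f l + p.fbar l := by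
  rw [parts, Multiset.count_add, Multiset.count_eq_of_nodup p.lined.nodup]
  rfl

theorem zero_notMem_parts (p : Overpartition) : 0 ∉ p.parts := by
  intro h
  rcases Multiset.mem_add.1 h with h | h
  · exact lt_irrefl 0 (p.plain_pos 0 h)
  · exact lt_irrefl 0 (p.lined_pos 0 h)

theorem f_add_fbar_zero (p : Overpartition) : p.f 0 + p.fbar 0 = 0 := by
  rw [← count_parts, Multiset.count_eq_zero]
  exact p.zero_notMem_parts

theorem size_eq (p : Overpartition) : p.size = p.plain.sum + ∑ l ∈ p.lined, l := by
  rw [size, parts, Multiset.sum_add, Finset.sum_val]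
  simp

/-! ### The difference condition in terms of frequencies -/

/-- The number of parts that are at least `m`. -/
def numGE (p : Overpartition) (m : ℕ) : ℕ := p.seq.countP (m ≤ ·)

theorem le_seq_iff (p : Overpartition) (m : ℕ) {i : ℕ} (hi : i < p.seq.length) :
    m ≤ p.seq[i] ↔ i < p.numGE m :=
  List.Pairwise.le_getElem_iff_lt_countP (Multiset.pairwise_sort _ _) m i hi

theorem numGE_le_length (p : Overpartition) (m : ℕ) : p.numGE m ≤ p.seq.length :=
  List.countP_le_length

theorem numGE_eq (p : Overpartition) (m : ℕ) :
    p.numGE m = p.numGE (m + 1) + (p.f m + p.fbar m) := by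
  have h : p.seq.count m = p.f m + p.fbar m := by
    rw [← count_parts, ← Multiset.coe_count, seq, Multiset.sort_eq]
  rw [← h]
  unfold numGE
  generalize p.seq = L
  induction L with
  | nil => simp
  | cons x L ih =>
    simp only [List.countP_cons, List.count_cons, ih, decide_eq_true_eq, beq_iff_eq]
    split_ifs <;> omega

/-- The copies of `m` occupy the positions from `numGE (m + 1)` up to, but not including, `numGE m`,
so the first copy sits at `numGE (m + 1)`. -/
theorem isOverlinedAt_iff (p : Overpartition) {i : ℕ} (hi : i < p.seq.length) :
    p.IsOverlinedAt i ↔ p.seq[i] ∈ p.lined ∧ i = p.numGE (p.seq[i] + 1) := by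
  have hge : p.numGE (p.seq[i] + 1) ≤ i := by
    have := p.le_seq_iff (p.seq[i] + 1) hi
    omega
  constructor
  · rintro ⟨_, hl, hfirst⟩
    refine ⟨hl, le_antisymm (not_lt.1 fun hlt => ?_) hge⟩
    have hn := hlt.trans hi
    have h1 := p.le_seq_iff (p.seq[i] + 1) hn
    have h2 := p.le_seq_iff p.seq[i] hn
    have h3 := p.le_seq_iff p.seq[i] hi
    have := hfirst _ hlt
    omega
  · rintro ⟨hl, heq⟩
    refine ⟨hi, hl, fun j hj h => ?_⟩
    have := p.le_seq_iff (p.seq[i] + 1) (hj.trans hi)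
    omega

theorem isBbar_iff {k a : ℕ} (ha : 1 ≤ a) (hak : a ≤ k) (p : Overpartition) :
    p.IsBbar k a ↔
      p.f 1 ≤ a - 1 ∧ ∀ l, 1 ≤ l → p.f l + p.fbar l + p.f (l + 1) ≤ k - 1 := by
  constructor
  · rintro ⟨h1, hd⟩
    refine ⟨h1, fun l _ => not_lt.1 fun hlt => ?_⟩
    have e0 := p.numGE_eq l
    have e1 : p.numGE (l + 1) = p.numGE (l + 2) + _ := p.numGE_eq (l + 1)
    have hlen := p.numGE_le_length l
    -- If the inequality fails, a window of `k` parts starts at the first position after all parts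
    -- `≥ l + 1`, or, when `l + 1` occurs plain, at its first plain copy. The last entry is at least
    -- `l`, so the drop is `0` in the first case and at most `1` from a non-overlined part in the
    -- second.
    by_cases hf : p.f (l + 1) = 0
    · have hi : p.numGE (l + 1) < p.seq.length := by omega
      have hj : p.numGE (l + 1) + (k - 1) < p.seq.length := by omega
      have hd' := hd _ _ hi hj (by omega)
      have hii := p.le_seq_iff (l + 1) hi
      have hjj := p.le_seq_iff l hj
      by_cases ho : p.IsOverlinedAt (p.numGE (l + 1))
      · have := hd'.1 ho
        omega
      · have := hd'.2 ho
        omega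
    · have hi : p.numGE (l + 2) + p.fbar (l + 1) < p.seq.length := by omega
      have hj : p.numGE (l + 2) + p.fbar (l + 1) + (k - 1) < p.seq.length := by omega
      have hd' := hd _ _ hi hj (by omega)
      have hii := p.le_seq_iff (l + 2) hi
      have hii' := p.le_seq_iff (l + 1) hi
      have hjj := p.le_seq_iff l hj
      have hval : p.seq[p.numGE (l + 2) + p.fbar (l + 1)] = l + 1 := by omega
      have ho : ¬ p.IsOverlinedAt (p.numGE (l + 2) + p.fbar (l + 1)) := by
        rw [isOverlinedAt_iff p hi, hval]
        rintro ⟨hl, he⟩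
        have he' : _ = p.numGE (l + 2) := he
        rw [fbar_of_mem hl] at he'
        omega
      have := hd'.2 ho
      omega
  · rintro ⟨h1, hadj⟩
    refine ⟨h1, fun i j hi hj hij => ?_⟩
    have hii := p.le_seq_iff p.seq[i] hi
    have hii' := p.le_seq_iff (p.seq[i] + 1) hi
    have hpos : p.seq[i] ≠ 0 := fun h0 => p.zero_notMem_parts (by
      rw [← h0]
      exact (Multiset.mem_sort _).1 (List.getElem_mem hi))
    rw [isOverlinedAt_iff p hi]
    generalize p.seq[i] = m at *
    obtain ⟨l, rfl⟩ := Nat.exists_eq_succ_of_ne_zero hpos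
    simp only [Nat.succ_eq_add_one, add_assoc, Nat.reduceAdd] at *
    have e0 := p.numGE_eq l
    have e1 : p.numGE (l + 1) = p.numGE (l + 2) + _ := p.numGE_eq (l + 1)
    have hjj := p.le_seq_iff (l + 1) hj
    have hjj' := p.le_seq_iff l hj
    constructor
    · rintro ⟨-, he⟩
      have := hadj (l + 1) (by omega)
      omega
    · intro ho
      -- A non-overlined copy of `l + 1` comes after the overlined one, if there is one. From there,
      -- `k - 1` steps pass every remaining `l + 1` and every `l`.
      have hge : p.numGE (l + 2) + p.fbar (l + 1) ≤ i := by
        by_cases hl : l + 1 ∈ p.lined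
        · have : i ≠ p.numGE (l + 2) := fun h => ho ⟨hl, h⟩
          rw [fbar_of_mem hl]
          omega
        · rw [fbar, if_neg hl]
          omega
      -- For `l = 0` the adjacency bound is not available; `f 1 ≤ a - 1 ≤ k - 1` replaces it and
      -- pushes `j` beyond the end of the sequence.
      rcases Nat.eq_zero_or_pos l with rfl | hl
      · have := p.f_add_fbar_zero
        simp only [zero_add] at *
        omega
      · have := hadj l hl
        omega

/-! ### The bijection -/

/-- The conditions defining `U_{k,a}` and `Ubar_{k,a}`, with the set of odd, respectively even,
numbers replaced by an arbitrary predicate. -/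
structure IsRestricted (P : ℕ → Prop) (k a : ℕ) (p : Overpartition) : Prop where
  one : p.f 1 ≤ (a - 1) + p.fbar 1
  le : ∀ l, P l → p.fbar l ≤ p.f l
  even : ∀ l, ¬ P l → Even (p.f l + p.fbar l)
  adjacent : ∀ l, 1 ≤ l → p.f l + p.fbar l + p.f (l + 1) ≤ (k - 1) + p.fbar (l + 1)

theorem isU_iff (k a : ℕ) (p : Overpartition) : p.IsU k a ↔ p.IsRestricted Odd k a :=
  ⟨fun h => ⟨h.one, h.odd, fun l hl => h.even l (Nat.not_odd_iff_even.1 hl), h.adjacent⟩,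
    fun h => ⟨h.one, h.le, fun l hl => h.even l (Nat.not_odd_iff_even.2 hl), h.adjacent⟩⟩

theorem isUbar_iff (k a : ℕ) (p : Overpartition) : p.IsUbar k a ↔ p.IsRestricted Even k a :=
  ⟨fun h => ⟨h.one, h.even, fun l hl => h.odd l (Nat.not_even_iff_odd.1 hl), h.adjacent⟩,
    fun h => ⟨h.one, h.le, fun l hl => h.even l (Nat.not_even_iff_odd.2 hl), h.adjacent⟩⟩

/-- The `l` satisfying `P` whose total multiplicity is odd. -/
def removed (P : ℕ → Prop) [DecidablePred P] (p : Overpartition) : Finset ℕ :=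
  p.parts.toFinset.filter fun l => P l ∧ Odd (p.f l + p.fbar l)

theorem mem_removed {P : ℕ → Prop} [DecidablePred P] {p : Overpartition} {l : ℕ} :
    l ∈ p.removed P ↔ P l ∧ Odd (p.f l + p.fbar l) := by
  rw [removed, Finset.mem_filter, Multiset.mem_toFinset, and_iff_right_iff_imp, ← count_parts,
    ← Multiset.count_pos]
  exact fun h => h.2.pos

theorem pos_of_mem_removed {P : ℕ → Prop} [DecidablePred P] {p : Overpartition} {l : ℕ}
    (h : l ∈ p.removed P) : 0 < l := by
  rcases Nat.eq_zero_or_pos l with rfl | hl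
  · have := (mem_removed.1 h).2
    rw [f_add_fbar_zero] at this
    exact absurd this (by decide)
  · exact hl

theorem f_remove (p : Overpartition) (s : Finset ℕ) (l : ℕ) :
    (p.remove s).f l = p.f l - if l ∈ s then 1 else 0 := by
  simp only [f, remove, Multiset.count_sub, Multiset.count_eq_of_nodup s.nodup, Finset.mem_val]

theorem f_mergeHalve (p : Overpartition) (l : ℕ) :
    p.mergeHalve.f l = (p.f l + p.fbar l) / 2 - p.fbar l := by
  have h : l ∉ p.parts → p.f l + p.fbar l = 0 := by
    rw [← count_parts]
    exact Multiset.count_eq_zero_of_notMem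
  change Multiset.count l (∑ m ∈ p.parts.toFinset, _) = _
  rw [Multiset.count_sum']
  simp only [Multiset.count_replicate, Finset.sum_ite_eq', Multiset.mem_toFinset]
  split_ifs with hl
  · rfl
  · rw [h hl]
    simp

/-- The inverse of the bijection: double each multiplicity and insert the elements of `s`. -/
def doubleInsert (s : Finset ℕ) (hs : ∀ l ∈ s, 0 < l) (p : Overpartition) : Overpartition where
  plain := 2 • p.plain + p.lined.val + s.val
  lined := p.lined
  plain_pos l hl := by
    rcases Multiset.mem_add.1 hl with hl | hl
    · rcases Multiset.mem_add.1 hl with hl | hl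
      · exact p.plain_pos l (Multiset.mem_of_mem_nsmul hl)
      · exact p.lined_pos l hl
    · exact hs l hl
  lined_pos := p.lined_pos

section doubleInsert

variable {s : Finset ℕ} (hs : ∀ l ∈ s, 0 < l) (p : Overpartition)

theorem f_doubleInsert (l : ℕ) :
    (doubleInsert s hs p).f l = 2 * p.f l + p.fbar l + if l ∈ s then 1 else 0 := by
  simp only [f, fbar, doubleInsert, Multiset.count_add, Multiset.count_nsmul,
    Multiset.count_eq_of_nodup s.nodup, Multiset.count_eq_of_nodup p.lined.nodup, Finset.mem_val]

theorem fbar_doubleInsert (l : ℕ) : (doubleInsert s hs p).fbar l = p.fbar l := rfl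

theorem size_doubleInsert : (doubleInsert s hs p).size = ∑ l ∈ s, l + 2 * p.size := by
  have h : ∀ t : Finset ℕ, t.val.sum = ∑ l ∈ t, l := fun t => Finset.sum_val t
  simp only [size_eq, doubleInsert, Multiset.sum_add, Multiset.sum_nsmul, h, smul_eq_mul]
  ring

/-- The total multiplicity of `l` is `2 * (f l + fbar l) + [l ∈ s]`, so its parity detects
membership in `s`. -/
theorem removed_doubleInsert {P : ℕ → Prop} [DecidablePred P] (hP : ∀ l ∈ s, P l) :
    (doubleInsert s hs p).removed P = s := by
  ext l
  rw [mem_removed, f_doubleInsert, fbar_doubleInsert, Nat.odd_iff]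
  split_ifs with h
  · exact ⟨fun _ => h, fun _ => ⟨hP l h, by omega⟩⟩
  · exact ⟨fun h' => absurd h'.2 (by omega), fun h' => absurd h' h⟩

theorem mergeHalve_remove_doubleInsert : ((doubleInsert s hs p).remove s).mergeHalve = p := by
  refine ext_f (fun l => ?_) rfl
  rw [f_mergeHalve, f_remove, f_doubleInsert,
    show ((doubleInsert s hs p).remove s).fbar l = p.fbar l from rfl]
  omega

theorem isRestricted_doubleInsert_iff {P : ℕ → Prop} (hP : ∀ l, P l → ¬ P (l + 1))
    (hsP : ∀ l ∈ s, P l) {k a : ℕ} (ha : 1 ≤ a) (hak : a ≤ k) :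
    (doubleInsert s hs p).IsRestricted P (2 * k) (2 * a) ↔ p.IsBbar k a := by
  -- This is the slack between `2 * (k - 1)` and `2 * k - 1`.
  have hsum : ∀ l, ((if l ∈ s then 1 else 0) + if l + 1 ∈ s then 1 else 0 : ℕ) ≤ 1 := by
    intro l
    by_cases h : l ∈ s
    · rw [if_neg fun h' => hP l (hsP l h) (hsP _ h')]
      split_ifs
      all_goals simp
    · rw [if_neg h]
      split_ifs
      all_goals simp
  rw [isBbar_iff ha hak]
  constructor
  · rintro ⟨h1, -, -, hadj⟩
    rw [f_doubleInsert, fbar_doubleInsert] at h1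
    refine ⟨by omega, fun l hl => ?_⟩
    have := hadj l hl
    rw [f_doubleInsert, f_doubleInsert, fbar_doubleInsert, fbar_doubleInsert] at this
    omega
  · rintro ⟨h1, hadj⟩
    refine ⟨?_, fun l _ => ?_, fun l hl => ?_, fun l hl => ?_⟩
    · rw [f_doubleInsert, fbar_doubleInsert]
      split_ifs <;> omega
    · rw [f_doubleInsert, fbar_doubleInsert]
      omega
    · rw [f_doubleInsert, fbar_doubleInsert, if_neg fun h => hl (hsP l h), Nat.even_iff]
      omega
    · have := hadj l hl
      have := hsum l
      rw [f_doubleInsert, f_doubleInsert, fbar_doubleInsert, fbar_doubleInsert]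
      omega

end doubleInsert

/-- Only `le` and `even` matter. For `P l`, `le` excludes a lone overlined `l`, which would leave no
plain copy to remove; with the parity conditions, no subtraction truncates. -/
theorem IsRestricted.doubleInsert_removed {P : ℕ → Prop} [DecidablePred P] {k a : ℕ}
    {p : Overpartition} (h : p.IsRestricted P k a) :
    doubleInsert (p.removed P) (fun _ => pos_of_mem_removed)
      (p.remove (p.removed P)).mergeHalve = p := by
  refine ext_f (fun l => ?_) rfl
  rw [f_doubleInsert, f_mergeHalve, f_remove,
    show (p.remove (p.removed P)).mergeHalve.fbar l = p.fbar l from rfl,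
    show (p.remove (p.removed P)).fbar l = p.fbar l from rfl]
  have hb := p.fbar_le_one l
  by_cases hl : P l
  · have hle := h.le l hl
    simp only [mem_removed, hl, true_and, Nat.odd_iff]
    split_ifs <;> omega
  · have he := Nat.even_iff.1 (h.even l hl)
    simp only [mem_removed, hl, false_and, if_false]
    omega

theorem bijOn_removed_mergeHalve (P : ℕ → Prop) [DecidablePred P] (hP : ∀ l, P l → ¬ P (l + 1))
    {k a : ℕ} (ha : 1 ≤ a) (hak : a ≤ k) (n : ℕ) :
    Set.BijOn (fun p : Overpartition => (p.removed P, (p.remove (p.removed P)).mergeHalve))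
      {p | p.size = n ∧ p.IsRestricted P (2 * k) (2 * a)}
      {x : Finset ℕ × Overpartition | (∀ l ∈ x.1, 0 < l ∧ P l) ∧ x.2.IsBbar k a ∧
        (∑ l ∈ x.1, l) + 2 * x.2.size = n} := by
  refine ⟨?_, ?_, ?_⟩
  · rintro p ⟨hn, hp⟩
    have hinv := hp.doubleInsert_removed
    have hm : ∀ l ∈ p.removed P, P l := fun l hl => (mem_removed.1 hl).1
    refine ⟨fun l hl => ⟨pos_of_mem_removed hl, hm l hl⟩, ?_, ?_⟩
    · rw [← hinv] at hp
      exact (isRestricted_doubleInsert_iff _ _ hP hm ha hak).1 hp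
    · rw [← hinv, size_doubleInsert] at hn
      exact hn
  · rintro p ⟨-, hp⟩ r ⟨-, hr⟩ h
    obtain ⟨h1, h2⟩ := Prod.mk.inj h
    rw [← hp.doubleInsert_removed, ← hr.doubleInsert_removed]
    congr 1
  · rintro ⟨s, p⟩ ⟨hs, hp, hn⟩
    have hpos : ∀ l ∈ s, 0 < l := fun l hl => (hs l hl).1
    have hsP : ∀ l ∈ s, P l := fun l hl => (hs l hl).2
    refine ⟨doubleInsert s hpos p, ⟨(size_doubleInsert hpos p).trans hn,
      (isRestricted_doubleInsert_iff hpos p hP hsP ha hak).2 hp⟩, ?_⟩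
    simp only [removed_doubleInsert hpos p hsP, mergeHalve_remove_doubleInsert]

end Overpartition

/-! ### Generating functions -/

/-- The partitions of `n` into distinct positive parts that satisfy `P`. -/
def distinctParts (P : ℕ → Prop) (n : ℕ) : Set (Finset ℕ) :=
  {s | (∀ l ∈ s, 0 < l ∧ P l) ∧ ∑ l ∈ s, l = n}

theorem finite_distinctParts (P : ℕ → Prop) (n : ℕ) : (distinctParts P n).Finite := by
  refine (Finset.finite_toSet (Finset.range (n + 1)).powerset).subset ?_
  rintro s ⟨-, hs⟩
  refine Finset.mem_coe.2 (Finset.mem_powerset.2 fun l hl => Finset.mem_range.2 ?_)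
  have := Finset.single_le_sum (f := fun l : ℕ => l) (fun _ _ => Nat.zero_le _) hl
  omega

section

open scoped PowerSeries.WithPiTopology

/-- Expanding the product gives one monomial for each finite index set, and `e` carries the index
sets of weight `n` bijectively onto `distinctParts P n`. So each coefficient is a finite sum of
ones. -/
theorem tprod_one_add_X_pow (P : ℕ → Prop) (e : ℕ → ℕ) (he : Function.Injective e)
    (hP : Set.range e = {l | 0 < l ∧ P l}) :
    ∏' i, (1 + X ^ e i : ℤ⟦X⟧) = PowerSeries.mk fun n => ((distinctParts P n).ncard : ℤ) := by
  refine (hasProd_one_add_of_hasSum_prod ?_).tprod_eq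
  rw [PowerSeries.WithPiTopology.hasSum_iff_hasSum_coeff]
  intro n
  have himage : (fun s : Finset ℕ => s.map ⟨e, he⟩) '' {s | ∑ i ∈ s, e i = n} =
      distinctParts P n := by
    ext t
    constructor
    · rintro ⟨s, hs, rfl⟩
      refine ⟨fun l hl => ?_, by simpa using hs⟩
      obtain ⟨i, -, rfl⟩ := Finset.mem_map.1 hl
      exact hP.subset ⟨i, rfl⟩
    · rintro ⟨ht, hsum⟩
      have hmap : (t.preimage e he.injOn).map ⟨e, he⟩ = t := by
        ext l
        simp only [Finset.mem_map, Finset.mem_preimage, Function.Embedding.coeFn_mk]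
        constructor
        · rintro ⟨i, hi, rfl⟩
          exact hi
        · intro hl
          obtain ⟨i, rfl⟩ := hP.superset (ht l hl)
          exact ⟨i, hl, rfl⟩
      refine ⟨t.preimage e he.injOn, ?_, hmap⟩
      rw [← hmap, Finset.sum_map] at hsum
      exact hsum
  have hinj : Function.Injective fun s : Finset ℕ => s.map ⟨e, he⟩ := Finset.map_injective _
  have hfin : {s : Finset ℕ | ∑ i ∈ s, e i = n}.Finite :=
    Set.Finite.of_finite_image (himage ▸ finite_distinctParts P n) hinj.injOn
  have hcard : (distinctParts P n).ncard = hfin.toFinset.card := by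
    rw [← himage, Set.ncard_image_of_injective _ hinj, Set.ncard_eq_toFinset_card _ hfin]
  rw [PowerSeries.coeff_mk, hcard, Finset.card_eq_sum_ones, Nat.cast_sum]
  have hcoeff : ∀ s : Finset ℕ, coeff n (∏ i ∈ s, (X : ℤ⟦X⟧) ^ e i) =
      if ∑ i ∈ s, e i = n then 1 else 0 := by
    intro s
    rw [Finset.prod_pow_eq_pow_sum, PowerSeries.coeff_X_pow]
    simp only [eq_comm]
  have hsum : ∑ s ∈ hfin.toFinset, ((1 : ℕ) : ℤ) =
      ∑ s ∈ hfin.toFinset, coeff n (∏ i ∈ s, (X : ℤ⟦X⟧) ^ e i) := by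
    refine Finset.sum_congr rfl fun s hs => ?_
    have hs' : ∑ i ∈ s, e i = n := (Set.Finite.mem_toFinset hfin).1 hs
    rw [hcoeff, if_pos hs', Nat.cast_one]
  rw [hsum]
  refine hasSum_sum_of_ne_finset_zero fun s hs => ?_
  have hs' : ¬ ∑ i ∈ s, e i = n := fun h => hs ((Set.Finite.mem_toFinset hfin).2 h)
  rw [hcoeff, if_neg hs']

end

/-- The pairs are fibred over the weights `(∑ l ∈ s, l, 2 * p.size)`; an odd second weight has an
empty fibre, matching the zero coefficients of `expand 2`. -/
theorem ncard_pairs_eq (P : ℕ → Prop) (k a n : ℕ) :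
    {x : Finset ℕ × Overpartition | (∀ l ∈ x.1, 0 < l ∧ P l) ∧ x.2.IsBbar k a ∧
      (∑ l ∈ x.1, l) + 2 * x.2.size = n}.ncard =
    ∑ ij ∈ Finset.HasAntidiagonal.antidiagonal n, (distinctParts P ij.1).ncard *
      if 2 ∣ ij.2 then Overpartition.Bbar k a (ij.2 / 2) else 0 := by
  classical
  have hBfin : ∀ j, {p : Overpartition | p.IsBbar k a ∧ 2 * p.size = j}.Finite := fun j =>
    (Overpartition.finite_size_eq (j / 2)).subset fun p hp => by
      have := hp.2
      change p.size = j / 2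
      omega
  have hB : ∀ j, {p : Overpartition | p.IsBbar k a ∧ 2 * p.size = j}.ncard =
      if 2 ∣ j then Overpartition.Bbar k a (j / 2) else 0 := by
    intro j
    split_ifs with h
    · unfold Overpartition.Bbar
      congr 1
      ext p
      simp only [Set.mem_ofPred_eq]
      constructor
      · exact fun hp => ⟨by omega, hp.1⟩
      · exact fun hp => ⟨hp.2, by omega⟩
    · rw [Set.ncard_eq_zero (hBfin j), Set.eq_empty_iff_forall_notMem]
      exact fun p hp => h ⟨_, hp.2.symm⟩
  have hset : {x : Finset ℕ × Overpartition | (∀ l ∈ x.1, 0 < l ∧ P l) ∧ x.2.IsBbar k a ∧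
      (∑ l ∈ x.1, l) + 2 * x.2.size = n} =
      ↑((Finset.HasAntidiagonal.antidiagonal n).biUnion fun ij =>
        (finite_distinctParts P ij.1).toFinset ×ˢ (hBfin ij.2).toFinset) := by
    ext ⟨s, p⟩
    simp only [Set.mem_ofPred_eq, Finset.coe_biUnion, Set.mem_iUnion, Finset.mem_coe,
      Finset.mem_product, Set.Finite.mem_toFinset, Finset.HasAntidiagonal.mem_antidiagonal, distinctParts,
      exists_prop, Prod.exists]
    constructor
    · rintro ⟨h1, h2, h3⟩
      exact ⟨_, _, h3, ⟨h1, rfl⟩, h2, rfl⟩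
    · rintro ⟨i, j, h, ⟨h1, rfl⟩, h2, rfl⟩
      exact ⟨h1, h2, h⟩
  rw [hset, Set.ncard_coe_finset, Finset.card_biUnion]
  · refine Finset.sum_congr rfl fun ij _ => ?_
    rw [Finset.card_product, ← Set.ncard_eq_toFinset_card _ (finite_distinctParts P ij.1),
      ← Set.ncard_eq_toFinset_card _ (hBfin ij.2), hB]
  · intro x _ y _ hxy
    refine Finset.disjoint_left.2 ?_
    rintro ⟨s, p⟩ h h'
    simp only [Finset.mem_product, Set.Finite.mem_toFinset, distinctParts,
      Set.mem_ofPred_eq] at h h'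
    exact hxy (Prod.ext (h.1.2.symm.trans h'.1.2) (h.2.2.symm.trans h'.2.2))

theorem mk_ncard_isRestricted (P : ℕ → Prop) [DecidablePred P] (hP : ∀ l, P l → ¬ P (l + 1))
    {k a : ℕ} (ha : 1 ≤ a) (hak : a ≤ k) :
    (PowerSeries.mk fun n =>
      ({p : Overpartition | p.size = n ∧ p.IsRestricted P (2 * k) (2 * a)}.ncard : ℤ)) =
    (PowerSeries.mk fun n => ((distinctParts P n).ncard : ℤ)) *
      PowerSeries.expand 2 two_ne_zero
        (PowerSeries.mk fun n => (Overpartition.Bbar k a n : ℤ)) := by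
  ext n
  have hbij := Overpartition.bijOn_removed_mergeHalve P hP ha hak n
  rw [PowerSeries.coeff_mk, ← hbij.injOn.ncard_image, hbij.image_eq, ncard_pairs_eq,
    PowerSeries.coeff_mul, Nat.cast_sum]
  refine Finset.sum_congr rfl fun ij _ => ?_
  rw [PowerSeries.coeff_expand, PowerSeries.coeff_mk, PowerSeries.coeff_mk, Nat.cast_mul,
    Nat.cast_ite, Nat.cast_zero]

theorem qPoch_neg_X : qPoch (-X) (X ^ 2) =
    PowerSeries.mk fun n => ((distinctParts Odd n).ncard : ℤ) := by
  rw [← tprod_one_add_X_pow Odd (fun i => 2 * i + 1) (fun i j h => by simpa using h)]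
  · unfold qPoch
    congr 1
    ext1 i
    ring
  · ext l
    constructor
    · rintro ⟨i, rfl⟩
      exact ⟨Nat.succ_pos _, i, rfl⟩
    · rintro ⟨-, i, rfl⟩
      exact ⟨i, rfl⟩

theorem qPoch_neg_X_sq : qPoch (-X ^ 2) (X ^ 2) =
    PowerSeries.mk fun n => ((distinctParts Even n).ncard : ℤ) := by
  -- The enumeration starts at `2`, since `0` is even but not a part.
  rw [← tprod_one_add_X_pow Even (fun i => 2 * i + 2) (fun i j h => by simpa using h)]
  · unfold qPoch
    congr 1
    ext1 i
    ring
  · ext l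
    simp only [Set.mem_range, Set.mem_ofPred_eq, Nat.even_iff]
    constructor
    · rintro ⟨i, rfl⟩
      omega
    · rintro ⟨h0, h⟩
      exact ⟨l / 2 - 1, by omega⟩

theorem mainTheorem8 (k a : ℕ) (ha : 1 ≤ a) (hak : a ≤ k) :
    -- `∑ U_{2k,2a}(n) q^n = (-q; q^2)_∞ ∑ Bbar_{k,a}(n) q^{2n}`
    (PowerSeries.mk (fun n => (Overpartition.U (2 * k) (2 * a) n : ℤ)) =
      qPoch (-X) (X ^ 2) *
        PowerSeries.expand 2 two_ne_zero
          (PowerSeries.mk fun n => (Overpartition.Bbar k a n : ℤ))) ∧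
    -- `∑ Ubar_{2k,2a}(n) q^n = (-q^2; q^2)_∞ ∑ Bbar_{k,a}(n) q^{2n}`
    (PowerSeries.mk (fun n => (Overpartition.Ubar (2 * k) (2 * a) n : ℤ)) =
      qPoch (-X ^ 2) (X ^ 2) *
        PowerSeries.expand 2 two_ne_zero
          (PowerSeries.mk fun n => (Overpartition.Bbar k a n : ℤ))) ∧
    -- the bijection behind the first identity
    (∀ n : ℕ, Set.BijOn
      (fun p : Overpartition => (p.oddRemoved, (p.remove p.oddRemoved).mergeHalve))
      {p | p.size = n ∧ p.IsU (2 * k) (2 * a)}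
      {x : Finset ℕ × Overpartition |
        (∀ l ∈ x.1, Odd l) ∧ x.2.IsBbar k a ∧ (∑ l ∈ x.1, l) + 2 * x.2.size = n}) ∧
    -- the bijection behind the second identity
    (∀ n : ℕ, Set.BijOn
      (fun p : Overpartition => (p.evenRemoved, (p.remove p.evenRemoved).mergeHalve))
      {p | p.size = n ∧ p.IsUbar (2 * k) (2 * a)}
      {x : Finset ℕ × Overpartition |
        (∀ l ∈ x.1, 0 < l ∧ Even l) ∧ x.2.IsBbar k a ∧
          (∑ l ∈ x.1, l) + 2 * x.2.size = n}) := by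
  have hodd : ∀ l : ℕ, Odd l → ¬ Odd (l + 1) := fun l h => Nat.not_odd_iff_even.2 h.add_one
  have heven : ∀ l : ℕ, Even l → ¬ Even (l + 1) := fun l h => Nat.not_even_iff_odd.2 h.add_one
  refine ⟨?_, ?_, fun n => ?_, fun n => ?_⟩
  · rw [qPoch_neg_X, ← mk_ncard_isRestricted Odd hodd ha hak]
    simp only [Overpartition.U, Overpartition.isU_iff]
  · rw [qPoch_neg_X_sq, ← mk_ncard_isRestricted Even heven ha hak]
    simp only [Overpartition.Ubar, Overpartition.isUbar_iff]
  · simp only [Overpartition.isU_iff]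
    have hpos : ∀ l : ℕ, Odd l ↔ 0 < l ∧ Odd l := fun l => ⟨fun h => ⟨h.pos, h⟩, And.right⟩
    have hset : {x : Finset ℕ × Overpartition |
        (∀ l ∈ x.1, Odd l) ∧ x.2.IsBbar k a ∧ (∑ l ∈ x.1, l) + 2 * x.2.size = n} =
        {x | (∀ l ∈ x.1, 0 < l ∧ Odd l) ∧ x.2.IsBbar k a ∧
          (∑ l ∈ x.1, l) + 2 * x.2.size = n} :=
      Set.ext fun x => and_congr_left fun _ => forall₂_congr fun l _ => hpos l
    rw [hset]
    exact Overpartition.bijOn_removed_mergeHalve Odd hodd ha hak n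
  · simp only [Overpartition.isUbar_iff]
    exact Overpartition.bijOn_removed_mergeHalve Even heven ha hak n
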